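/- Let $(A,\mathfrak m)$ be a Noetherian local ring of Krull dimension $d$ whose residue field $k=A/\mathfrak m$ is algebraically closed, and let $I$ be an $\mathfrak m$-primary ideal that is integrally closed, i.e. $I$ contains every $x\in A$ that satisfies an equation $x^n+a_1x^{n-1}+\dots+a_n=0$ with $n\ge 1$ and $a_i\in I^i$ for $1\le i\le n$. Let $R=\bigoplus_{n\ge 0} I^n/\mathfrak m I^n$ be the fiber cone of $I$. (1) Sending a point $\mathfrak p\in\operatorname{Proj}(R)$ to the ideal $$I'_{\mathfrak p}=\{x\in I : \text{the class of } x \text{ in } R_1=I/\mathfrak m I \text{ lies in } \mathfrak p\}$$ restricts to a bijection from the set of closed points of $\operatorname{Proj}(R)$ onto the set of integrally closed ideals $I'\subset I$ of $A$ with $l_A(I/I')=1$. (2) In particular these ideals form an algebraic variety of dimension $d-1$ (possibly reducible), in the following sense: they are, via (1), the closed points of $\operatorname{Proj}(R)$, which is a proper scheme over $k$ and which has dimension $d-1$ if $d\ge 1$ and is empty if $d=0$. -/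

import Mathlib

open AlgebraicGeometry IsLocalRing Polynomial CategoryTheory

universe u

/-- `x` is integral over the ideal `I`: it satisfies an equation
`x ^ n + a₁ x ^ (n - 1) + ⋯ + aₙ = 0` with `n ≥ 1` and `aᵢ ∈ I ^ i`. -/
def IsIntegralOverIdeal {A : Type u} [CommRing A] (I : Ideal A) (x : A) : Prop :=
  ∃ n : ℕ, 0 < n ∧ ∃ a : ℕ → A, (∀ i ∈ Finset.Icc 1 n, a i ∈ I ^ i) ∧
    x ^ n + ∑ i ∈ Finset.Icc 1 n, a i * x ^ (n - i) = 0

/-- The ideal `I` contains every element of the ring that is integral over it. -/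
def IsIntegrallyClosedIdeal {A : Type u} [CommRing A] (I : Ideal A) : Prop :=
  ∀ x : A, IsIntegralOverIdeal I x → x ∈ I

section FiberCone

variable {A : Type u} [CommRing A] [IsLocalRing A] (I : Ideal A)

/-- The fiber cone `⨁ Iⁿ / 𝔪Iⁿ` of `I`, as the quotient `A[It] / 𝔪A[It]` of the Rees algebra.
Its grading is `fiberConePiece`, and `fiberConePieceEquiv` identifies the piece of degree `n`
with `Iⁿ / 𝔪Iⁿ`. -/
def FiberCone : Type u :=
  ↥(reesAlgebra I) ⧸ (maximalIdeal A).map (algebraMap A ↥(reesAlgebra I))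

noncomputable instance fiberConeCommRing : CommRing (FiberCone I) :=
  inferInstanceAs
    (CommRing (↥(reesAlgebra I) ⧸ (maximalIdeal A).map (algebraMap A ↥(reesAlgebra I))))

noncomputable instance fiberConeAlgebra : Algebra A (FiberCone I) :=
  inferInstanceAs
    (Algebra A (↥(reesAlgebra I) ⧸ (maximalIdeal A).map (algebraMap A ↥(reesAlgebra I))))

/-- The quotient map `A[It] → A[It] / 𝔪A[It]`. -/
noncomputable def fiberConeMk : ↥(reesAlgebra I) →ₐ[A] FiberCone I :=
  Ideal.Quotient.mkₐ A ((maximalIdeal A).map (algebraMap A ↥(reesAlgebra I)))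

theorem fiberConeMk_surjective : Function.Surjective (fiberConeMk I) :=
  Ideal.Quotient.mkₐ_surjective A _

theorem fiberConeMk_eq_zero_iff (f : ↥(reesAlgebra I)) :
    fiberConeMk I f = 0 ↔ f ∈ (maximalIdeal A).map (algebraMap A ↥(reesAlgebra I)) :=
  Ideal.Quotient.eq_zero_iff_mem

/-- The map `Iⁿ → A[It]`, `r ↦ r tⁿ`. -/
noncomputable def reesOf (n : ℕ) : ↥(I ^ n) →ₗ[A] ↥(reesAlgebra I) where
  toFun r := ⟨monomial n (r : A), reesAlgebra.monomial_mem.mpr r.2⟩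
  map_add' r s := Subtype.ext (by simp)
  map_smul' a r := Subtype.ext (by simp [smul_monomial])

/-- The `n`-th coefficient `A[It] → Iⁿ`. -/
noncomputable def reesCoeff (n : ℕ) : ↥(reesAlgebra I) →ₗ[A] ↥(I ^ n) where
  toFun f := ⟨(f : A[X]).coeff n, f.2 n⟩
  map_add' f g := Subtype.ext (by simp)
  map_smul' a f := Subtype.ext (by simp)

/-- The map `Iⁿ → ⨁ Iⁿ / 𝔪Iⁿ` that sends an element to its class in degree `n`. -/
noncomputable def fiberConeOf (n : ℕ) : ↥(I ^ n) →ₗ[A] FiberCone I :=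
  (fiberConeMk I).toLinearMap ∘ₗ reesOf I n

/-- The homogeneous component of degree `n` of the fiber cone. -/
noncomputable def fiberConePiece (n : ℕ) : Submodule A (FiberCone I) :=
  LinearMap.range (fiberConeOf I n)

theorem reesCoeff_mem_smul_top {f : ↥(reesAlgebra I)}
    (hf : f ∈ (maximalIdeal A).map (algebraMap A ↥(reesAlgebra I))) (n : ℕ) :
    reesCoeff I n f ∈ maximalIdeal A • (⊤ : Submodule A ↥(I ^ n)) := by
  have h : f ∈ maximalIdeal A • (⊤ : Submodule A ↥(reesAlgebra I)) := by
    rw [Ideal.smul_top_eq_map]; exact hf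
  have h2 := Submodule.mem_map_of_mem (f := reesCoeff I n) h
  rw [Submodule.map_smul''] at h2
  exact Submodule.smul_mono le_rfl le_top h2

theorem fiberConeOf_eq_zero_iff (n : ℕ) (r : ↥(I ^ n)) :
    fiberConeOf I n r = 0 ↔ r ∈ maximalIdeal A • (⊤ : Submodule A ↥(I ^ n)) := by
  have e : fiberConeOf I n r = fiberConeMk I (reesOf I n r) := rfl
  rw [e, fiberConeMk_eq_zero_iff]
  constructor
  · intro h
    have h2 := reesCoeff_mem_smul_top I h n
    have h3 : reesCoeff I n (reesOf I n r) = r := Subtype.ext (by simp [reesCoeff, reesOf])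
    rwa [h3] at h2
  · intro h
    have h2 := Submodule.mem_map_of_mem (f := reesOf I n) h
    rw [Submodule.map_smul''] at h2
    have h3 : reesOf I n r ∈ maximalIdeal A • (⊤ : Submodule A ↥(reesAlgebra I)) :=
      Submodule.smul_mono le_rfl le_top h2
    rw [Ideal.smul_top_eq_map] at h3
    exact h3

/-- The component of degree `n` of the fiber cone is `Iⁿ / 𝔪Iⁿ`. -/
noncomputable def fiberConePieceEquiv (n : ℕ) :
    (↥(I ^ n) ⧸ (maximalIdeal A • (⊤ : Submodule A ↥(I ^ n)))) ≃ₗ[A] ↥(fiberConePiece I n) :=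
  (Submodule.quotEquivOfEq _ _
    (by ext r; rw [LinearMap.mem_ker, fiberConeOf_eq_zero_iff])).trans
    (fiberConeOf I n).quotKerEquivRange

/-- Under `fiberConePieceEquiv` the class of `r` corresponds to `fiberConeOf I n r`. -/
theorem fiberConePieceEquiv_mk (n : ℕ) (r : ↥(I ^ n)) :
    (fiberConePieceEquiv I n (Submodule.Quotient.mk r) : FiberCone I) = fiberConeOf I n r := rfl

/-- The product of the fiber cone is induced by the products `Iᵐ × Iⁿ → Iᵐ⁺ⁿ`. -/
theorem fiberConeOf_mul (m n : ℕ) (r : ↥(I ^ m)) (s : ↥(I ^ n)) :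
    fiberConeOf I m r * fiberConeOf I n s =
      fiberConeOf I (m + n)
        ⟨(r : A) * (s : A), by rw [pow_add]; exact Ideal.mul_mem_mul r.2 s.2⟩ := by
  have e : reesOf I m r * reesOf I n s = reesOf I (m + n)
      ⟨(r : A) * (s : A), by rw [pow_add]; exact Ideal.mul_mem_mul r.2 s.2⟩ :=
    Subtype.ext (by simp [reesOf, monomial_mul_monomial])
  have e2 := congrArg (fiberConeMk I) e
  rw [map_mul] at e2
  exact e2

theorem fiberCone_isInternal : DirectSum.IsInternal (fiberConePiece I) := by
  classical
  constructor
  · rw [injective_iff_map_eq_zero]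
    intro x hx
    have hr : ∀ i, ∃ r : ↥(I ^ i), fiberConeOf I i r = x i := fun i => (x i).2
    choose r hr using hr
    have h1 : (DirectSum.coeAddMonoidHom (fiberConePiece I)) x =
        fiberConeMk I (∑ i ∈ DFinsupp.support x, reesOf I i (r i)) := by
      rw [DirectSum.coeAddMonoidHom_eq_dfinsuppSum, DFinsupp.sum, map_sum]
      exact Finset.sum_congr rfl fun i _ => (hr i).symm
    rw [h1, fiberConeMk_eq_zero_iff] at hx
    ext i
    by_cases hi : i ∈ DFinsupp.support x
    · have h2 := reesCoeff_mem_smul_top I hx i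
      have h3 : reesCoeff I i (∑ j ∈ DFinsupp.support x, reesOf I j (r j)) = r i := by
        refine Subtype.ext ?_
        simp only [reesCoeff, reesOf, LinearMap.coe_mk, AddHom.coe_mk,
          AddSubmonoidClass.coe_finsetSum, finsetSum_coeff, coeff_monomial]
        rw [Finset.sum_eq_single i]
        · simp
        · intro j _ hj
          simp [hj]
        · intro h
          exact absurd hi h
      rw [h3, ← fiberConeOf_eq_zero_iff, hr] at h2
      simpa using h2
    · simpa using hi
  · intro y
    obtain ⟨f, rfl⟩ := fiberConeMk_surjective I y
    refine ⟨∑ i ∈ (f : A[X]).support,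
      DirectSum.of (fun i => ↥(fiberConePiece I i)) i
        ⟨fiberConeOf I i (reesCoeff I i f), LinearMap.mem_range_self _ _⟩, ?_⟩
    rw [map_sum]
    have h : f = ∑ i ∈ (f : A[X]).support, reesOf I i (reesCoeff I i f) := by
      refine Subtype.ext ?_
      conv_lhs => rw [(f : A[X]).as_sum_support]
      simp [reesOf, reesCoeff]
    have h2 := congrArg (fiberConeMk I) h
    rw [map_sum] at h2
    rw [h2]
    refine Finset.sum_congr rfl fun i _ => ?_
    rw [DirectSum.coeAddMonoidHom_of]
    rfl

noncomputable instance fiberConeGradedAlgebra : GradedAlgebra (fiberConePiece I) where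
  one_mem := by
    have e : reesOf I 0 ⟨1, by simp⟩ = 1 := Subtype.ext (by simp [reesOf])
    have e2 := congrArg (fiberConeMk I) e
    rw [map_one] at e2
    exact ⟨_, e2⟩
  mul_mem := by
    rintro i j _ _ ⟨r, rfl⟩ ⟨s, rfl⟩
    exact ⟨_, (fiberConeOf_mul I i j r s).symm⟩
  toDecomposition := (fiberCone_isInternal I).chooseDecomposition

/-- The scheme `Proj (⨁ Iⁿ / 𝔪Iⁿ)`. -/
noncomputable abbrev fiberConeProj : Scheme.{u} := Proj (fiberConePiece I)

/-- The canonical ring homomorphism from `k = A / 𝔪` to the degree `0` part of the fiber cone. -/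
noncomputable def residueFieldToFiberConeZero :
    ResidueField A →+* ↥(fiberConePiece I 0) :=
  Ideal.Quotient.lift (maximalIdeal A) (algebraMap A ↥(fiberConePiece I 0)) fun _ ha =>
    Subtype.ext ((fiberConeMk_eq_zero_iff I _).mpr (Ideal.mem_map_of_mem _ ha))

/-- The structure morphism `Proj (⨁ Iⁿ / 𝔪Iⁿ) ⟶ Spec k`. -/
noncomputable def fiberConeProjToSpec :
    fiberConeProj I ⟶ Spec (CommRingCat.of (ResidueField A)) :=
  Proj.toSpecZero (fiberConePiece I) ≫
    Spec.map (CommRingCat.ofHom (residueFieldToFiberConeZero I))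

/-- The set of ideals `I' ⊆ I` that are integrally closed and satisfy `length (I / I') = 1`. -/
def adjacentIntegrallyClosedIdeals : Set (Ideal A) :=
  {I' | I' ≤ I ∧ IsIntegrallyClosedIdeal I' ∧
    Module.length A (↥I ⧸ Submodule.comap (Submodule.subtype I) I') = 1}

/-- The ideal attached to a point `p` of `Proj (⨁ Iⁿ / 𝔪Iⁿ)`: it consists of the `x ∈ I` whose
class in `I / 𝔪I` lies in the degree `1` part of the homogeneous prime `p`. -/
noncomputable def idealOfPoint (p : fiberConeProj I) : Ideal A :=
  Submodule.map (Submodule.subtype (I ^ 1))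
    (Submodule.comap (fiberConeOf I 1)
      (Submodule.restrictScalars A (ProjectiveSpectrum.asHomogeneousIdeal p).toIdeal))

theorem mem_idealOfPoint (p : fiberConeProj I) (x : A) :
    x ∈ idealOfPoint I p ↔
      ∃ h : x ∈ I ^ 1, fiberConeOf I 1 ⟨x, h⟩ ∈ ProjectiveSpectrum.asHomogeneousIdeal p := by
  constructor
  · rintro ⟨y, hy, rfl⟩
    exact ⟨y.2, hy⟩
  · rintro ⟨h, hx⟩
    exact ⟨⟨x, h⟩, hx, rfl⟩

end FiberCone

/-! ### Degree-one generation of the fiber cone and points of `Proj`. -/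

section FiberConeBasic

variable {A : Type u} [CommRing A] [IsLocalRing A] (I : Ideal A)

/-! Write `R` for the fiber cone; it is generated over `k` in degree one.

Bijection. An integral equation of `y` over `I'_p`, read in degree `n` of `R`, puts the class of
`yⁿ` in `p`, hence that of `y`, so every `I'_p` is integrally closed. As `k` is algebraically
closed, a closed point is rational: `R₁ / p₁` is a line and `I / I'_p` has length one
(`idealOfPoint_mem_adjacent`). Conversely let `J ⊂ I` be integrally closed of colength one and `x ∈
I \ J`. Modulo `JR`, each degree of `R` is spanned by `xⁿ`. If `xⁿ ∈ JR` then `xⁿ ∈ J Iⁿ⁻¹`, and `I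
= J + (x)` turns this into an integral equation of `x` over `J`, which is impossible. So `R / JR` is
a polynomial ring in `x`, and `JR` is the required closed point (`idealOfPoint_bijOn`).

Dimension, upper bound. A chain of `e + 1` points forces the summed Hilbert function of `R` to grow
at least like `N ^ (e + 1)`; it is bounded by the length of `A / I ^ N`, which is `O(N ^ d)` by a
system of parameters (`lt_of_strictMono`).

Lower bound. If no chain has `d` points, then `d - 1` general hyperplanes have empty intersection,
so by Nakayama `d - 1` elements of `I` generate an ideal containing a power of `I`, against Krull's
height theorem (`exists_strictMono_of_ringKrullDim`). -/

theorem algebraMap_fiberCone_eq_zero {a : A} (ha : a ∈ maximalIdeal A) :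
    algebraMap A (FiberCone I) a = 0 :=
  (fiberConeMk_eq_zero_iff I _).mpr (Ideal.mem_map_of_mem _ ha)

theorem fiberCone_smul_eq_zero {a : A} (ha : a ∈ maximalIdeal A) (u : FiberCone I) :
    a • u = 0 := by
  rw [Algebra.smul_def, algebraMap_fiberCone_eq_zero I ha, zero_mul]

/-- The map `I → I / 𝔪I ⊆ ⨁ Iⁿ / 𝔪Iⁿ`. -/
noncomputable def fiberConeOne : ↥I →ₗ[A] FiberCone I :=
  fiberConeOf I 1 ∘ₗ (LinearEquiv.ofEq I (I ^ 1) (pow_one I).symm).toLinearMap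

theorem fiberConeOne_mem (y : I) : fiberConeOne I y ∈ fiberConePiece I 1 := ⟨_, rfl⟩

theorem mem_idealOfPoint_iff (p : fiberConeProj I) (y : I) :
    (y : A) ∈ idealOfPoint I p ↔
      fiberConeOne I y ∈ (ProjectiveSpectrum.asHomogeneousIdeal p).toIdeal := by
  rw [mem_idealOfPoint]
  exact ⟨fun ⟨_, h⟩ => h, fun h => ⟨_, h⟩⟩

theorem idealOfPoint_le (p : fiberConeProj I) : idealOfPoint I p ≤ I := by
  intro x hx
  obtain ⟨h, -⟩ := (mem_idealOfPoint I p x).mp hx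
  rwa [pow_one] at h

theorem fiberConeOne_mul (n : ℕ) (y : I) (s : ↥(I ^ n)) :
    fiberConeOne I y * fiberConeOf I n s =
      fiberConeOf I (n + 1)
        ⟨(y : A) * (s : A), by rw [pow_succ']; exact Ideal.mul_mem_mul y.2 s.2⟩ := by
  have e : reesOf I 1 ((LinearEquiv.ofEq I (I ^ 1) (pow_one I).symm) y) * reesOf I n s =
      reesOf I (n + 1)
        ⟨(y : A) * (s : A), by rw [pow_succ']; exact Ideal.mul_mem_mul y.2 s.2⟩ :=
    Subtype.ext (by simp [reesOf, monomial_mul_monomial, add_comm])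
  have e2 := congrArg (fiberConeMk I) e
  rw [map_mul] at e2
  exact e2

theorem fiberConeOf_pow (n : ℕ) (y : I) :
    fiberConeOf I n ⟨(y : A) ^ n, Ideal.pow_mem_pow y.2 n⟩ = fiberConeOne I y ^ n := by
  induction n with
  | zero =>
    have e : reesOf I 0 ⟨(y : A) ^ 0, Ideal.pow_mem_pow y.2 0⟩ = 1 :=
      Subtype.ext (by simp [reesOf])
    have e2 := congrArg (fiberConeMk I) e
    rw [map_one] at e2
    exact e2.trans (pow_zero _).symm
  | succ n ih =>
    refine Eq.trans ?_ (pow_succ' _ _).symm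
    rw [← ih, fiberConeOne_mul]
    exact congrArg _ (Subtype.ext (pow_succ' _ _))

theorem fiberConeOne_pow_mem (n : ℕ) (y : I) : fiberConeOne I y ^ n ∈ fiberConePiece I n :=
  ⟨_, fiberConeOf_pow I n y⟩

theorem fiberConePiece_zero (u : FiberCone I) (hu : u ∈ fiberConePiece I 0) :
    ∃ a : A, u = a • 1 := by
  obtain ⟨r, rfl⟩ := hu
  refine ⟨r, ?_⟩
  have e : reesOf I 0 r = (r : A) • 1 := Subtype.ext (by simp [reesOf, smul_eq_C_mul])
  have e2 := congrArg (fiberConeMk I) e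
  rw [map_smul, map_one] at e2
  exact e2

theorem fiberConePiece_succ_induction {n : ℕ} {C : FiberCone I → Prop}
    (hmul : ∀ (y : I), ∀ v ∈ fiberConePiece I n, C (fiberConeOne I y * v))
    (hadd : ∀ u v, C u → C v → C (u + v)) : ∀ u ∈ fiberConePiece I (n + 1), C u := by
  rintro _ ⟨⟨r, hr⟩, rfl⟩
  have key : ∀ a (_ : a ∈ I * I ^ n), ∀ h : a ∈ I ^ (n + 1), C (fiberConeOf I (n + 1) ⟨a, h⟩) := by
    intro a ha
    refine Submodule.mul_induction_on' (C := fun a _ => ∀ h : a ∈ I ^ (n + 1),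
      C (fiberConeOf I (n + 1) ⟨a, h⟩)) ?_ ?_ ha
    · intro y hy s hs h
      have := hmul ⟨y, hy⟩ (fiberConeOf I n ⟨s, hs⟩) ⟨_, rfl⟩
      rwa [fiberConeOne_mul] at this
    · intro a ha b hb iha ihb h
      rw [← pow_succ'] at ha hb
      have := hadd _ _ (iha ha) (ihb hb)
      rwa [← map_add] at this
  exact key r (by rwa [← pow_succ']) hr

theorem exists_sub_smul_pow_mem (p : Ideal (FiberCone I)) (x : I)
    (h : ∀ y : I, ∃ a : A, fiberConeOne I y - a • fiberConeOne I x ∈ p) (n : ℕ) :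
    ∀ u ∈ fiberConePiece I n, ∃ a : A, u - a • fiberConeOne I x ^ n ∈ p := by
  induction n with
  | zero =>
    intro u hu
    obtain ⟨a, rfl⟩ := fiberConePiece_zero I u hu
    exact ⟨a, by simp⟩
  | succ n ih =>
    refine fiberConePiece_succ_induction I ?_ ?_
    · intro y v hv
      obtain ⟨a, ha⟩ := ih v hv
      obtain ⟨b, hb⟩ := h y
      refine ⟨b * a, ?_⟩
      have : fiberConeOne I y * v - (b * a) • fiberConeOne I x ^ (n + 1) =
          (fiberConeOne I y - b • fiberConeOne I x) * v +
            (b • fiberConeOne I x) * (v - a • fiberConeOne I x ^ n) := by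
        simp only [Algebra.smul_def, map_mul]; ring
      rw [this]
      exact p.add_mem (p.mul_mem_right _ hb) (p.mul_mem_left _ ha)
    · rintro u v ⟨a, ha⟩ ⟨b, hb⟩
      refine ⟨a + b, ?_⟩
      rw [add_smul, add_sub_add_comm]
      exact p.add_mem ha hb

theorem mem_maximalIdeal_of_smul_pow_mem {p : Ideal (FiberCone I)} {x : I}
    (hp : ∀ n, fiberConeOne I x ^ n ∉ p)
    {a : A} {n : ℕ} (h : a • fiberConeOne I x ^ n ∈ p) : a ∈ maximalIdeal A := by
  rw [mem_maximalIdeal, mem_nonunits_iff]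
  rintro ⟨b, rfl⟩
  refine hp n ?_
  have := p.mul_mem_left (algebraMap A _ (↑b⁻¹ : A)) h
  rwa [← Algebra.smul_def, smul_smul, Units.inv_mul, one_smul] at this

theorem irrelevant_le_of_fiberConeOne_mem {p : HomogeneousIdeal (fiberConePiece I)}
    (h : ∀ y : I, fiberConeOne I y ∈ p.toIdeal) :
    HomogeneousIdeal.irrelevant (fiberConePiece I) ≤ p := by
  rw [HomogeneousIdeal.irrelevant_le]
  intro i hi u hu
  obtain ⟨n, rfl⟩ := Nat.exists_eq_succ_of_ne_zero hi.ne'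
  exact fiberConePiece_succ_induction I (C := (· ∈ p.toIdeal))
    (fun y v _ => p.toIdeal.mul_mem_right _ (h y)) (fun _ _ => p.toIdeal.add_mem) u hu

theorem exists_fiberConeOne_notMem (p : fiberConeProj I) :
    ∃ x : I, fiberConeOne I x ∉ (ProjectiveSpectrum.asHomogeneousIdeal p).toIdeal := by
  by_contra! h
  exact p.not_irrelevant_le (irrelevant_le_of_fiberConeOne_mem I h)

/-- A relevant prime containing `S` cannot contain `x`, so it contains `u ≡ a xⁿ` only when `a ∈ 𝔪`,
that is, when `u ∈ S`. This gives both injectivity and the closedness of the point built from `J`.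
-/
theorem fiberConeProj_eq_of_le {S : Ideal (FiberCone I)} {x : I}
    (h : ∀ y : I, ∃ a : A, fiberConeOne I y - a • fiberConeOne I x ∈ S)
    {p q : ProjectiveSpectrum (fiberConePiece I)} (hp : S ≤ p.asHomogeneousIdeal.toIdeal)
    (hq : S ≤ q.asHomogeneousIdeal.toIdeal) : p = q := by
  have key : ∀ p : ProjectiveSpectrum (fiberConePiece I), S ≤ p.asHomogeneousIdeal.toIdeal →
      ∀ n, ∀ u ∈ fiberConePiece I n, u ∈ p.asHomogeneousIdeal.toIdeal ↔ u ∈ S := by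
    intro p hp n u hu
    refine ⟨fun hup => ?_, fun h => hp h⟩
    have hx : fiberConeOne I x ∉ p.asHomogeneousIdeal.toIdeal := by
      intro hx
      obtain ⟨y, hy⟩ := exists_fiberConeOne_notMem I p
      obtain ⟨a, ha⟩ := h y
      have := Ideal.add_mem _ (hp ha) (Ideal.mul_mem_left _ (algebraMap A _ a) hx)
      rw [← Algebra.smul_def, sub_add_cancel] at this
      exact hy this
    obtain ⟨a, ha⟩ := exists_sub_smul_pow_mem I S x h n u hu
    have h1 : a • fiberConeOne I x ^ n ∈ p.asHomogeneousIdeal.toIdeal := by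
      have := Ideal.sub_mem _ hup (hp ha)
      rwa [sub_sub_cancel] at this
    have h2 := mem_maximalIdeal_of_smul_pow_mem I (fun n hn => hx (p.isPrime.mem_of_pow_mem n hn)) h1
    rwa [fiberCone_smul_eq_zero I h2, sub_zero] at ha
  refine ProjectiveSpectrum.ext (HomogeneousIdeal.ext' fun n u hu => ?_)
  exact (key p hp n u hu).trans (key q hq n u hu).symm

/-- The quotient by `S` has `xⁿ` as a `k`-basis of degree `n`, so it is a polynomial ring in `x`. -/
theorem isPrime_of_pow_notMem {S : Ideal (FiberCone I)} (hS : S.IsHomogeneous (fiberConePiece I))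
    {x : I} (h : ∀ y : I, ∃ a : A, fiberConeOne I y - a • fiberConeOne I x ∈ S)
    (hx : ∀ n, fiberConeOne I x ^ n ∉ S) : S.IsPrime := by
  refine hS.isPrime_of_homogeneous_mem_or_mem ?_ ?_
  · rintro rfl
    exact hx 0 trivial
  · rintro u v ⟨m, hu⟩ ⟨n, hv⟩ huv
    obtain ⟨a, ha⟩ := exists_sub_smul_pow_mem I S x h m u hu
    obtain ⟨b, hb⟩ := exists_sub_smul_pow_mem I S x h n v hv
    have h1 : (a * b) • fiberConeOne I x ^ (m + n) ∈ S := by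
      have : (a * b) • fiberConeOne I x ^ (m + n) = u * v - (u - a • fiberConeOne I x ^ m) * v -
          (a • fiberConeOne I x ^ m) * (v - b • fiberConeOne I x ^ n) := by
        simp only [Algebra.smul_def, map_mul]; ring
      rw [this]
      exact S.sub_mem (S.sub_mem huv (S.mul_mem_right _ ha)) (S.mul_mem_left _ hb)
    rcases (maximalIdeal.isMaximal A).isPrime.mem_or_mem (mem_maximalIdeal_of_smul_pow_mem I hx h1)
      with h2 | h2
    · left; rwa [fiberCone_smul_eq_zero I h2, sub_zero] at ha
    · right; rwa [fiberCone_smul_eq_zero I h2, sub_zero] at hb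

theorem isClosed_singleton_iff_forall_le (p : ProjectiveSpectrum (fiberConePiece I)) :
    IsClosed ({p} : Set (ProjectiveSpectrum (fiberConePiece I))) ↔ ∀ q, p ≤ q → q = p := by
  rw [← closure_subset_iff_isClosed]
  simp only [Set.subset_def, ← ProjectiveSpectrum.le_iff_mem_closure, Set.mem_singleton_iff]

end FiberConeBasic

/-! ### Integral equations over ideals, and colength one. -/

section Integrality

variable {A : Type u} [CommRing A]

/-- Elements of `(J + (x)) ^ n` are forms of degree `n` in `x` with coefficients in powers of `J`. -/
theorem exists_sum_of_mem_pow {I J : Ideal A} {x : A} (h : I ≤ J ⊔ Ideal.span {x}) (n : ℕ) :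
    ∀ b ∈ I ^ n, ∃ c : ℕ → A, (∀ i, c i ∈ J ^ i) ∧
      b = ∑ ij ∈ Finset.HasAntidiagonal.antidiagonal n, c ij.1 * x ^ ij.2 := by
  induction n with
  | zero =>
    intro b _
    exact ⟨fun i => if i = 0 then b else 0, fun i => by by_cases h : i = 0 <;> simp [h], by simp⟩
  | succ n ih =>
    intro b hb
    rw [pow_succ'] at hb
    induction hb using Submodule.mul_induction_on' with
    | mem_mul_mem y hy b hb =>
      obtain ⟨c, hc, rfl⟩ := ih b hb
      obtain ⟨z, hz, w, hw, rfl⟩ := Submodule.mem_sup.mp (h hy)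
      obtain ⟨e, rfl⟩ := Ideal.mem_span_singleton'.mp hw
      -- Multiplying by `z ∈ J` shifts the coefficients up by one, multiplying by `e * x` does not;
      -- the cut-offs erase the values of `c` at the indices `-1` and `n + 1`, outside the sum.
      refine ⟨fun i => (if i = 0 then 0 else z * c (i - 1)) + if i = n + 1 then 0 else e * c i,
        fun i => Ideal.add_mem _ ?_ ?_, ?_⟩
      · split_ifs with hi
        · simp
        · obtain ⟨j, rfl⟩ := Nat.exists_eq_succ_of_ne_zero hi
          rw [Nat.succ_eq_add_one, pow_succ']
          exact Ideal.mul_mem_mul hz (hc j)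
      · split_ifs with hi
        · simp
        · exact Ideal.mul_mem_left _ _ (hc i)
      · simp only [add_mul, Finset.sum_add_distrib, Finset.mul_sum]
        congr 1
        · rw [Finset.Nat.sum_antidiagonal_succ]
          simp [mul_assoc]
        · rw [Finset.Nat.sum_antidiagonal_succ']
          simp only [if_true, zero_mul, zero_add]
          refine Finset.sum_congr rfl fun ij hij => ?_
          rw [Finset.HasAntidiagonal.mem_antidiagonal] at hij
          rw [if_neg (by omega), pow_succ]; ring
    | add a _ b _ iha ihb =>
      obtain ⟨c, hc, rfl⟩ := iha
      obtain ⟨d, hd, rfl⟩ := ihb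
      exact ⟨c + d, fun i => Ideal.add_mem _ (hc i) (hd i), by
        simp [add_mul, Finset.sum_add_distrib]⟩

theorem exists_sum_of_mem_mul_pow {I J : Ideal A} {x : A} (h : I ≤ J ⊔ Ideal.span {x}) (n : ℕ) :
    ∀ b ∈ J * I ^ n, ∃ c : ℕ → A, (∀ i, c i ∈ J ^ (i + 1)) ∧
      b = ∑ ij ∈ Finset.HasAntidiagonal.antidiagonal n, c ij.1 * x ^ ij.2 := by
  intro b hb
  induction hb using Submodule.mul_induction_on' with
  | mem_mul_mem y hy b hb =>
    obtain ⟨c, hc, rfl⟩ := exists_sum_of_mem_pow h n b hb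
    refine ⟨fun i => y * c i, fun i => ?_, by simp [Finset.mul_sum, mul_assoc]⟩
    rw [pow_succ']
    exact Ideal.mul_mem_mul hy (hc i)
  | add a _ b _ iha ihb =>
    obtain ⟨c, hc, rfl⟩ := iha
    obtain ⟨d, hd, rfl⟩ := ihb
    exact ⟨c + d, fun i => Ideal.add_mem _ (hc i) (hd i), by
      simp [add_mul, Finset.sum_add_distrib]⟩

/-- Expanding in powers of `x` gives `xⁿ⁺¹ = ∑ cᵢ xⁿ⁻ⁱ` with `cᵢ ∈ Jⁱ⁺¹`, already an integral
equation. -/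
theorem isIntegralOverIdeal_of_pow_mem {I J : Ideal A} {x : A} (h : I ≤ J ⊔ Ideal.span {x}) {n : ℕ}
    (hx : x ^ (n + 1) ∈ J * I ^ n) : IsIntegralOverIdeal J x := by
  obtain ⟨c, hc, hcx⟩ := exists_sum_of_mem_mul_pow h n _ hx
  refine ⟨n + 1, n.succ_pos, fun i => - c (i - 1), fun i hi => ?_, ?_⟩
  · obtain ⟨j, rfl⟩ := Nat.exists_eq_add_of_le' (Finset.mem_Icc.mp hi).1
    exact neg_mem (hc j)
  · have e : Finset.Icc 1 (n + 1) = Finset.Ico 1 (n + 2) := by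
      ext i; simp only [Finset.mem_Icc, Finset.mem_Ico]; omega
    rw [hcx, e, Finset.sum_Ico_eq_sum_range, Finset.Nat.sum_antidiagonal_eq_sum_range_succ_mk,
      show n + 2 - 1 = n + 1 from rfl, ← Finset.sum_add_distrib]
    refine Finset.sum_eq_zero fun i hi => ?_
    simp only [show 1 + i - 1 = i by omega, show n + 1 - (1 + i) = n - i by omega]
    ring

theorem IsIntegralOverIdeal.mono {I J : Ideal A} (h : J ≤ I) {x : A}
    (hx : IsIntegralOverIdeal J x) : IsIntegralOverIdeal I x := by
  obtain ⟨n, hn, a, ha, e⟩ := hx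
  exact ⟨n, hn, a, fun i hi => Ideal.pow_right_mono h i (ha i hi), e⟩

theorem length_eq_one_iff_covBy {I J : Ideal A} (hJ : J ≤ I) :
    Module.length A (↥I ⧸ Submodule.comap (Submodule.subtype I) J) = 1 ↔ J ⋖ I := by
  rw [Module.length_eq_one_iff, covBy_iff_quot_is_simple hJ]

theorem le_sup_span_of_covBy {I J : Ideal A} (h : J ⋖ I) {x : A} (hx : x ∈ I) (hxJ : x ∉ J) :
    I ≤ J ⊔ Ideal.span {x} := by
  have h1 : J < J ⊔ Ideal.span {x} := by
    refine lt_of_le_of_ne le_sup_left fun e => hxJ ?_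
    rw [e]
    exact Ideal.mem_sup_right (Ideal.mem_span_singleton_self x)
  have h2 : J ⊔ Ideal.span {x} ≤ I := sup_le h.le (by simpa [Ideal.span_singleton_le_iff_mem])
  exact ((h.eq_or_eq h1.le h2).resolve_left h1.ne').ge

end Integrality

/-! ### From ideals to homogeneous ideals of the fiber cone and back. -/

section Bijection

variable {A : Type u} [CommRing A] [IsLocalRing A] (I : Ideal A)

/-- The ideal of the fiber cone generated by the classes in degree one of the elements of `J`. -/
noncomputable def fiberConeSpan (J : Ideal A) : Ideal (FiberCone I) :=
  Ideal.span (fiberConeOne I '' {y | (y : A) ∈ J})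

theorem fiberConeSpan_isHomogeneous (J : Ideal A) :
    (fiberConeSpan I J).IsHomogeneous (fiberConePiece I) := by
  refine Ideal.homogeneous_span _ _ ?_
  rintro _ ⟨y, -, rfl⟩
  exact ⟨1, fiberConeOne_mem I y⟩

theorem fiberConeSpan_le_iff (J : Ideal A) (p : Ideal (FiberCone I)) :
    fiberConeSpan I J ≤ p ↔ ∀ y : I, (y : A) ∈ J → fiberConeOne I y ∈ p := by
  rw [fiberConeSpan, Ideal.span_le, Set.image_subset_iff]
  rfl

theorem exists_sub_smul_mem_fiberConeSpan {J : Ideal A} (hJ : J ≤ I) {x : I}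
    (h : I ≤ J ⊔ Ideal.span {(x : A)}) (y : I) :
    ∃ a : A, fiberConeOne I y - a • fiberConeOne I x ∈ fiberConeSpan I J := by
  obtain ⟨z, hz, w, hw, e⟩ := Submodule.mem_sup.mp (h y.2)
  obtain ⟨a, rfl⟩ := Ideal.mem_span_singleton'.mp hw
  refine ⟨a, ?_⟩
  have : y = (⟨z, hJ hz⟩ : I) + a • x := Subtype.ext e.symm
  rw [this, map_add, map_smul, add_sub_cancel_right]
  exact Ideal.subset_span ⟨_, hz, rfl⟩

/-- The elements `f` of the Rees algebra with `f₀ ∈ 𝔪` and `fₙ₊₁ ∈ J Iⁿ`. -/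
noncomputable def reesIdeal {J : Ideal A} (hm : maximalIdeal A * I ≤ J) :
    Ideal ↥(reesAlgebra I) where
  carrier := {f | (f : A[X]).coeff 0 ∈ maximalIdeal A ∧ ∀ n, (f : A[X]).coeff (n + 1) ∈ J * I ^ n}
  add_mem' := by
    rintro f g ⟨hf, hf'⟩ ⟨hg, hg'⟩
    refine ⟨?_, fun n => ?_⟩
    · simpa using Ideal.add_mem _ hf hg
    · simpa using Ideal.add_mem _ (hf' n) (hg' n)
  zero_mem' := by simp
  smul_mem' := by
    rintro g f ⟨hf, hf'⟩
    refine ⟨?_, fun n => ?_⟩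
    · simpa [mul_coeff_zero] using Ideal.mul_mem_left _ _ hf
    · simp only [smul_eq_mul, Subalgebra.coe_mul, coeff_mul]
      refine Ideal.sum_mem _ fun ij hij => ?_
      rw [Finset.HasAntidiagonal.mem_antidiagonal] at hij
      obtain ⟨i, j⟩ := ij
      -- The constant coefficient of `f` is only known to lie in `𝔪`; `hm` carries `𝔪 Iⁿ⁺¹` into `J
      -- Iⁿ`.
      rcases j with _ | j
      · obtain rfl : i = n + 1 := by simpa using hij
        have h1 := Ideal.mul_mem_mul hf (g.2 (n + 1))
        rw [pow_succ', ← mul_assoc, mul_comm (Polynomial.coeff _ _)] at h1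
        exact Ideal.mul_mono_left hm h1
      · obtain rfl : i + j = n := by simpa [← add_assoc] using hij
        have h1 := Ideal.mul_mem_mul (hf' j) (g.2 i)
        rwa [mul_comm (Polynomial.coeff _ _), mul_assoc, ← pow_add, add_comm j] at h1

/-- Both `𝔪A[It]` and `Jt` lie in `reesIdeal`. This lifts membership in the quotient to a condition
on coefficients in `A`. -/
theorem mem_reesIdeal_of_mem_fiberConeSpan {J : Ideal A} (hm : maximalIdeal A * I ≤ J)
    {f : ↥(reesAlgebra I)} (hf : fiberConeMk I f ∈ fiberConeSpan I J) : f ∈ reesIdeal I hm := by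
  have h0 : (maximalIdeal A).map (algebraMap A ↥(reesAlgebra I)) ≤ reesIdeal I hm := by
    rw [Ideal.map_le_iff_le_comap]
    intro a ha
    refine ⟨by simpa using ha, fun n => ?_⟩
    simp
  have h1 : fiberConeSpan I J ≤ (reesIdeal I hm).map (fiberConeMk I) := by
    rw [fiberConeSpan_le_iff]
    intro y hy
    refine Ideal.mem_map_of_mem (f := fiberConeMk I)
      (x := reesOf I 1 (LinearEquiv.ofEq I (I ^ 1) (pow_one I).symm y)) ⟨?_, fun n => ?_⟩
    · simp [reesOf]
    · rcases n with _ | n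
      · simpa [reesOf] using hy
      · simp [reesOf, coeff_monomial]
  obtain ⟨g, hg, e⟩ := (Ideal.mem_map_iff_of_surjective (fiberConeMk I)
    (fiberConeMk_surjective I)).mp (h1 hf)
  have h2 : fiberConeMk I (f - g) = 0 := by rw [map_sub, e, sub_self]
  rw [fiberConeMk_eq_zero_iff] at h2
  have := Ideal.add_mem _ (h0 h2) hg
  rwa [sub_add_cancel] at this

theorem isIntegralOverIdeal_of_pow_mem_fiberConeSpan {J : Ideal A} (hm : maximalIdeal A * I ≤ J)
    {x : I} (h : I ≤ J ⊔ Ideal.span {(x : A)}) {n : ℕ}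
    (hx : fiberConeOne I x ^ n ∈ fiberConeSpan I J) : IsIntegralOverIdeal J (x : A) := by
  rw [← fiberConeOf_pow] at hx
  obtain ⟨h0, h1⟩ := mem_reesIdeal_of_mem_fiberConeSpan I hm
    (f := reesOf I n ⟨(x : A) ^ n, Ideal.pow_mem_pow x.2 n⟩) hx
  rcases n with _ | n
  · simp [reesOf] at h0
  · exact isIntegralOverIdeal_of_pow_mem h (n := n) (by simpa [reesOf] using h1 n)

theorem maximalIdeal_mul_le_of_covBy {J : Ideal A} (h : J ⋖ I) : maximalIdeal A * I ≤ J := by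
  have := (covBy_iff_quot_is_simple h.le).mp h
  have e : Module.annihilator A (↥I ⧸ Submodule.comap (Submodule.subtype I) J) = maximalIdeal A :=
    eq_maximalIdeal (IsSimpleModule.annihilator_isMaximal)
  rw [Ideal.mul_le]
  intro a ha y hy
  rw [← e, Module.mem_annihilator] at ha
  have := ha (Submodule.Quotient.mk ⟨y, hy⟩)
  rw [← Submodule.Quotient.mk_smul, Submodule.Quotient.mk_eq_zero] at this
  exact this

theorem covBy_of_le_sup_span {J : Ideal A} (hJ : J ≤ I) (hm : maximalIdeal A * I ≤ J) {x : A}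
    (hx : x ∈ I) (hxJ : x ∉ J) (h : I ≤ J ⊔ Ideal.span {x}) : J ⋖ I := by
  refine ⟨lt_of_le_of_ne hJ (by rintro rfl; exact hxJ hx), fun K hJK hKI => ?_⟩
  obtain ⟨y, hyK, hyJ⟩ := SetLike.exists_of_lt hJK
  obtain ⟨z, hz, w, hw, rfl⟩ := Submodule.mem_sup.mp (h (hKI.le hyK))
  obtain ⟨a, rfl⟩ := Ideal.mem_span_singleton'.mp hw
  have ha : IsUnit a := by
    by_contra ha
    exact hyJ (J.add_mem hz (hm (Ideal.mul_mem_mul ((mem_maximalIdeal a).mpr ha) hx)))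
  have hax : a * x ∈ K := by
    have := K.sub_mem hyK (hJK.le hz)
    rwa [add_sub_cancel_left] at this
  have hxK : x ∈ K := by
    obtain ⟨b, rfl⟩ := ha
    have := K.mul_mem_left (↑b⁻¹ : A) hax
    rwa [← mul_assoc, Units.inv_mul, one_mul] at this
  exact hKI.not_ge (h.trans (sup_le hJK.le (by simpa [Ideal.span_singleton_le_iff_mem])))

/-- Each term `aᵢ yⁿ⁻ⁱ` has its degree `n` class in the prime, because `i ≥ 1` puts the class of
`aᵢ` there. Closedness of the point plays no role. -/
theorem isIntegrallyClosedIdeal_idealOfPoint (hI : IsIntegrallyClosedIdeal I)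
    (p : fiberConeProj I) : IsIntegrallyClosedIdeal (idealOfPoint I p) := by
  intro y hy
  have hyI : y ∈ I := hI y (hy.mono (idealOfPoint_le I p))
  obtain ⟨n, hn, a, ha, e⟩ := hy
  set P := (ProjectiveSpectrum.asHomogeneousIdeal p).toIdeal with hP
  have hP' : P.IsPrime := ProjectiveSpectrum.isPrime p
  have key : ∀ i, ∀ b ∈ (idealOfPoint I p) ^ (i + 1), ∀ h : b ∈ I ^ (i + 1),
      fiberConeOf I (i + 1) ⟨b, h⟩ ∈ P := by
    intro i b hb
    rw [pow_succ'] at hb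
    induction hb using Submodule.mul_induction_on' with
    | mem_mul_mem y hy b hb =>
      intro h
      have h1 := (mem_idealOfPoint_iff I p ⟨y, idealOfPoint_le I p hy⟩).mp hy
      have h2 := P.mul_mem_right
        (fiberConeOf I i ⟨b, Ideal.pow_right_mono (idealOfPoint_le I p) i hb⟩) h1
      rwa [fiberConeOne_mul] at h2
    | add a ha b hb iha ihb =>
      intro h
      have hle : idealOfPoint I p * idealOfPoint I p ^ i ≤ I ^ (i + 1) := by
        rw [← pow_succ']; exact Ideal.pow_right_mono (idealOfPoint_le I p) _
      have := P.add_mem (iha (hle ha)) (ihb (hle hb))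
      rwa [← map_add] at this
  refine (mem_idealOfPoint_iff I p ⟨y, hyI⟩).mpr (hP'.mem_of_pow_mem n ?_)
  rw [← fiberConeOf_pow]
  have hmem : ∀ i ∈ Finset.Icc 1 n, a i * y ^ (n - i) ∈ I ^ n := by
    intro i hi
    have h1 := Ideal.mul_mem_mul (Ideal.pow_right_mono (idealOfPoint_le I p) i (ha i hi))
      (Ideal.pow_mem_pow hyI (n - i))
    rwa [← pow_add, Nat.add_sub_cancel' (Finset.mem_Icc.mp hi).2] at h1
  have e1 : (⟨y ^ n, Ideal.pow_mem_pow hyI n⟩ : ↥(I ^ n)) =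
      - ∑ i ∈ (Finset.Icc 1 n).attach, ⟨a i * y ^ (n - i), hmem i i.2⟩ := by
    refine Subtype.ext ?_
    simp only [NegMemClass.coe_neg, AddSubmonoidClass.coe_finsetSum]
    rw [Finset.sum_attach (Finset.Icc 1 n) (fun i => a i * y ^ (n - i))]
    exact eq_neg_of_add_eq_zero_left e
  rw [e1, map_neg, map_sum]
  refine neg_mem (sum_mem fun i _ => ?_)
  obtain ⟨i, hi⟩ := i
  obtain ⟨hi1, hi2⟩ := Finset.mem_Icc.mp hi
  obtain ⟨j, rfl⟩ := Nat.exists_eq_add_of_le' hi1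
  obtain ⟨l, rfl⟩ := Nat.exists_eq_add_of_le hi2
  have h1 := P.mul_mem_right (fiberConeOf I l ⟨y ^ l, Ideal.pow_mem_pow hyI l⟩)
    (key j (a (j + 1)) (ha _ hi) (Ideal.pow_right_mono (idealOfPoint_le I p) _ (ha _ hi)))
  rw [fiberConeOf_mul] at h1
  convert h1 using 4
  simp

end Bijection

/-! ### Rationality of closed points, and the bijection. -/

section ResidueFieldAlgebra

variable {A : Type u} [CommRing A] [IsLocalRing A] (I : Ideal A)

/-- The fiber cone is an algebra over the residue field. -/
noncomputable instance fiberConeResidueAlgebra : Algebra (ResidueField A) (FiberCone I) :=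
  (Ideal.Quotient.lift (maximalIdeal A) (algebraMap A (FiberCone I))
    fun _ ha => algebraMap_fiberCone_eq_zero I ha).toAlgebra

instance fiberConeResidueTower : IsScalarTower A (ResidueField A) (FiberCone I) :=
  IsScalarTower.of_algebraMap_eq fun _ => rfl

instance fiberConeFiniteType [IsNoetherianRing A] : Algebra.FiniteType A (FiberCone I) :=
  Algebra.FiniteType.of_surjective (fiberConeMk I) (fiberConeMk_surjective I)

instance fiberConeResidueFiniteType [IsNoetherianRing A] :
    Algebra.FiniteType (ResidueField A) (FiberCone I) :=
  Algebra.FiniteType.of_restrictScalars_finiteType A _ _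

instance fiberConeIsNoetherianRing [IsNoetherianRing A] : IsNoetherianRing (FiberCone I) :=
  Algebra.FiniteType.isNoetherianRing A _

theorem fiberConeSpan_idealOfPoint_le (p : fiberConeProj I) :
    fiberConeSpan I (idealOfPoint I p) ≤ (ProjectiveSpectrum.asHomogeneousIdeal p).toIdeal :=
  (fiberConeSpan_le_iff I _ _).mpr fun y hy => (mem_idealOfPoint_iff I p y).mp hy

variable [IsNoetherianRing A] [IsAlgClosed (ResidueField A)]

/-- Zariski's lemma: the residue field at `M` is finite over the algebraically closed `k`, hence
equal to it. -/
theorem exists_sub_smul_one_mem (M : Ideal (FiberCone I)) [M.IsMaximal] (u : FiberCone I) :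
    ∃ a : A, u - a • 1 ∈ M := by
  let := Ideal.Quotient.field M
  have : Module.Finite (ResidueField A) (FiberCone I ⧸ M) :=
    finite_of_finite_type_of_isJacobsonRing _ _
  obtain ⟨c, hc⟩ := (IsAlgClosed.algebraMap_bijective_of_isIntegral
    (k := ResidueField A) (K := FiberCone I ⧸ M)).2 (Ideal.Quotient.mk M u)
  obtain ⟨a, rfl⟩ := IsLocalRing.residue_surjective c
  refine ⟨a, Ideal.Quotient.eq.mp ?_⟩
  rw [← hc, ← Algebra.algebraMap_eq_smul_one]
  rfl

theorem exists_forall_sub_smul_mem_of_isClosed (p : ProjectiveSpectrum (fiberConePiece I))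
    (hp : IsClosed ({p} : Set (ProjectiveSpectrum (fiberConePiece I)))) :
    ∃ x : I, fiberConeOne I x ∉ p.asHomogeneousIdeal.toIdeal ∧
      ∀ y : I, ∃ a : A, fiberConeOne I y - a • fiberConeOne I x ∈ p.asHomogeneousIdeal.toIdeal := by
  obtain ⟨x, hx⟩ := exists_fiberConeOne_notMem I p
  -- By the Jacobson property some maximal `M ⊇ p`, usually not homogeneous, misses `x`. Its
  -- homogeneous core is a point above `p`, hence `p` itself, so degree-one elements of `M` lie in
  -- `p`.
  have hJ : IsJacobsonRing (FiberCone I) := isJacobsonRing_of_finiteType (A := ResidueField A)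
  rw [← hJ.out p.isPrime.isRadical, Ideal.jacobson, Submodule.mem_sInf] at hx
  push Not at hx
  obtain ⟨M, ⟨hpM, hM⟩, hxM⟩ := hx
  let q : ProjectiveSpectrum (fiberConePiece I) :=
    ⟨Ideal.homogeneousCore (fiberConePiece I) M, Ideal.IsPrime.homogeneousCore hM.isPrime, fun h =>
      hxM (Ideal.toIdeal_homogeneousCore_le (fiberConePiece I) M
        (h (HomogeneousIdeal.mem_irrelevant_of_mem _ one_pos (fiberConeOne_mem I x))))⟩
  have hq : q = p := (isClosed_singleton_iff_forall_le I p).mp hp q <| by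
    rw [← ProjectiveSpectrum.as_ideal_le_as_ideal]
    exact (Ideal.homogeneousCore.gc (fiberConePiece I) _ _).mp hpM
  have hmem : ∀ y : I, fiberConeOne I y ∈ M → fiberConeOne I y ∈ p.asHomogeneousIdeal.toIdeal := by
    intro y hy
    rw [← hq]
    exact Ideal.mem_homogeneousCore_of_homogeneous_of_mem ⟨1, fiberConeOne_mem I y⟩ hy
  refine ⟨x, fun h => hxM (hpM h), fun y => ?_⟩
  obtain ⟨a, ha⟩ := exists_sub_smul_one_mem I M (fiberConeOne I x)
  obtain ⟨b, hb⟩ := exists_sub_smul_one_mem I M (fiberConeOne I y)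
  have hau : IsUnit a := by
    by_contra h
    rw [fiberCone_smul_eq_zero I ((mem_maximalIdeal a).mpr h), sub_zero] at ha
    exact hxM ha
  obtain ⟨a, rfl⟩ := hau
  -- Here `a` and `b` are the values of `x` and `y` at `M`, so `y - (b / a) x` vanishes there.
  refine ⟨b * (↑a⁻¹ : A), ?_⟩
  rw [← map_smul, ← map_sub]
  refine hmem _ ?_
  have : fiberConeOne I (y - (b * (↑a⁻¹ : A)) • x) = (fiberConeOne I y - b • 1) -
      algebraMap A _ (b * (↑a⁻¹ : A)) * (fiberConeOne I x - (a : A) • 1) := by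
    rw [map_sub, map_smul, mul_sub, ← Algebra.smul_def, ← Algebra.smul_def, smul_smul, mul_assoc,
      Units.inv_mul, mul_one]
    abel
  rw [this]
  exact M.sub_mem hb (Ideal.mul_mem_left M _ ha)

theorem idealOfPoint_mem_adjacent (hI : IsIntegrallyClosedIdeal I) (p : fiberConeProj I)
    (hp : IsClosed ({p} : Set (fiberConeProj I))) :
    idealOfPoint I p ∈ adjacentIntegrallyClosedIdeals I := by
  have hle := idealOfPoint_le I p
  refine ⟨hle, isIntegrallyClosedIdeal_idealOfPoint I hI p, ?_⟩
  rw [length_eq_one_iff_covBy hle]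
  obtain ⟨x, hx, h⟩ := exists_forall_sub_smul_mem_of_isClosed I p hp
  refine covBy_of_le_sup_span I hle ?_ x.2 (fun hx' => hx ((mem_idealOfPoint_iff I p x).mp hx')) ?_
  · rw [Ideal.mul_le]
    intro a ha y hy
    refine (mem_idealOfPoint_iff I p (a • ⟨y, hy⟩)).mpr ?_
    rw [map_smul, fiberCone_smul_eq_zero I ha]
    exact Ideal.zero_mem _
  · intro y hy
    obtain ⟨a, ha⟩ := h ⟨y, hy⟩
    rw [← map_smul, ← map_sub] at ha
    have h1 := (mem_idealOfPoint_iff I p _).mpr ha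
    exact Submodule.mem_sup.mpr ⟨_, h1, a * x, Ideal.mem_span_singleton'.mpr ⟨a, rfl⟩, by simp⟩

theorem idealOfPoint_bijOn (hI : IsIntegrallyClosedIdeal I) :
    Set.BijOn (idealOfPoint I) {p : fiberConeProj I | IsClosed ({p} : Set (fiberConeProj I))}
      (adjacentIntegrallyClosedIdeals I) := by
  refine ⟨fun p hp => idealOfPoint_mem_adjacent I hI p hp, ?_, ?_⟩
  · intro p hp q _ e
    obtain ⟨x, hx, h⟩ := exists_forall_sub_smul_mem_of_isClosed I p hp
    refine fiberConeProj_eq_of_le I (S := fiberConeSpan I (idealOfPoint I p)) (x := x)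
      (fun y => ?_) (fiberConeSpan_idealOfPoint_le I p)
      (by rw [e]; exact fiberConeSpan_idealOfPoint_le I q)
    obtain ⟨a, ha⟩ := h y
    refine ⟨a, ?_⟩
    rw [← map_smul, ← map_sub] at ha ⊢
    exact Ideal.subset_span ⟨_, (mem_idealOfPoint_iff I p _).mpr ha, rfl⟩
  · rintro J ⟨hJI, hJ, hlen⟩
    rw [length_eq_one_iff_covBy hJI] at hlen
    obtain ⟨x, hx, hxJ⟩ := SetLike.exists_of_lt hlen.lt
    lift x to I using hx
    have hm := maximalIdeal_mul_le_of_covBy I hlen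
    have hsup := le_sup_span_of_covBy hlen x.2 hxJ
    have h := exists_sub_smul_mem_fiberConeSpan I hJI hsup
    have hpow : ∀ n, fiberConeOne I x ^ n ∉ fiberConeSpan I J := fun n hn =>
      hxJ (hJ x (isIntegralOverIdeal_of_pow_mem_fiberConeSpan I hm hsup hn))
    let p : ProjectiveSpectrum (fiberConePiece I) :=
      ⟨⟨fiberConeSpan I J, fiberConeSpan_isHomogeneous I J⟩,
        isPrime_of_pow_notMem I (fiberConeSpan_isHomogeneous I J) h hpow, fun hirr => by
          have := hirr (HomogeneousIdeal.mem_irrelevant_of_mem _ one_pos (fiberConeOne_mem I x))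
          exact hpow 1 (by rwa [pow_one])⟩
    have hp : IsClosed ({p} : Set (ProjectiveSpectrum (fiberConePiece I))) :=
      (isClosed_singleton_iff_forall_le I p).mpr fun q hq =>
        fiberConeProj_eq_of_le I h ((ProjectiveSpectrum.as_ideal_le_as_ideal _ _ _).mpr hq) le_rfl
    refine ⟨p, hp, ?_⟩
    refine ((hlen.eq_or_eq ?_ (idealOfPoint_le I p)).resolve_right fun e => ?_)
    · intro y hy
      exact (mem_idealOfPoint_iff I p ⟨y, hJI hy⟩).mpr (Ideal.subset_span ⟨_, hy, rfl⟩)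
    · have h1 := (mem_idealOfPoint_iff I p x).mp (e.symm ▸ x.2 : (x : A) ∈ idealOfPoint I p)
      exact hpow 1 (by rw [pow_one]; exact h1)

end ResidueFieldAlgebra

/-! ### Properness over the residue field. -/

section Proper

variable {A : Type u} [CommRing A] [IsLocalRing A] (I : Ideal A)

instance fiberCone_nontrivial : Nontrivial (FiberCone I) := by
  refine ⟨1, 0, fun h => ?_⟩
  rw [← map_one (fiberConeMk I)] at h
  -- With `J = ⊤` only the condition in degree 0 has content; it would say `1 ∈ 𝔪`.
  have h1 := (mem_reesIdeal_of_mem_fiberConeSpan I (J := ⊤) le_top (f := 1)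
    (h ▸ Ideal.zero_mem _)).1
  simp at h1

theorem residueFieldToFiberConeZero_bijective :
    Function.Bijective (residueFieldToFiberConeZero I) := by
  have : Nontrivial ↥(fiberConePiece I 0) :=
    ⟨1, 0, fun h => one_ne_zero (α := FiberCone I) (congrArg Subtype.val h)⟩
  refine ⟨(residueFieldToFiberConeZero I).injective, ?_⟩
  rintro ⟨u, hu⟩
  obtain ⟨a, rfl⟩ := fiberConePiece_zero I u hu
  exact ⟨residue A a, Subtype.ext (Algebra.algebraMap_eq_smul_one a)⟩

theorem isProper_fiberConeProjToSpec [IsNoetherianRing A] :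
    IsProper (fiberConeProjToSpec I) := by
  have : IsScalarTower A ↥(fiberConePiece I 0) (FiberCone I) :=
    ⟨fun a b c => smul_mul_assoc a (b : FiberCone I) c⟩
  have : Algebra.FiniteType ↥(fiberConePiece I 0) (FiberCone I) :=
    Algebra.FiniteType.of_restrictScalars_finiteType A _ _
  have : IsIso (Spec.map (CommRingCat.ofHom (residueFieldToFiberConeZero I))) := by
    have : IsIso (CommRingCat.ofHom (residueFieldToFiberConeZero I)) :=
      (ConcreteCategory.isIso_iff_bijective _).mpr (residueFieldToFiberConeZero_bijective I)
    infer_instance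
  rw [fiberConeProjToSpec]
  infer_instance

end Proper

/-! ### Length estimates, and polynomial growth of the length of `A / Iⁿ`. -/

section Length

variable {A : Type*} [CommRing A] {M P Q : Type*} [AddCommGroup M] [Module A M]
  [AddCommGroup P] [Module A P] [AddCommGroup Q] [Module A Q]

theorem length_range_le_of_ker_le {f : M →ₗ[A] P} {g : M →ₗ[A] Q}
    (h : LinearMap.ker f ≤ LinearMap.ker g) :
    Module.length A (LinearMap.range g) ≤ Module.length A (LinearMap.range f) := by
  rw [← f.quotKerEquivRange.length_eq, ← g.quotKerEquivRange.length_eq]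
  exact Module.length_le_of_surjective (Submodule.factor h) (Submodule.factor_surjective h)

theorem length_submodule_mono {U V : Submodule A M} (h : U ≤ V) :
    Module.length A U ≤ Module.length A V :=
  Module.length_le_of_injective (Submodule.inclusion h) (Submodule.inclusion_injective h)

theorem length_add_length_map_le {U V : Submodule A M} (h : U ≤ V) (g : M →ₗ[A] P)
    (hg : U ≤ LinearMap.ker g) :
    Module.length A U + Module.length A (V.map g) ≤ Module.length A V := by
  have e := Module.length_eq_add_of_exact (LinearMap.ker (g.domRestrict V)).subtype
    (g.domRestrict V).rangeRestrict (Submodule.subtype_injective _)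
    (LinearMap.surjective_rangeRestrict _) (by
      rw [LinearMap.exact_iff, LinearMap.ker_rangeRestrict, Submodule.range_subtype])
  rw [e, LinearMap.range_domRestrict]
  refine add_le_add_left (Module.length_le_of_injective
    ((Submodule.inclusion h).codRestrict _ fun u => ?_) ?_) _
  · exact hg u.2
  · intro a b hab
    exact Submodule.inclusion_injective h (congrArg Subtype.val hab)

theorem length_le_add_of_ker_le_range {f : M →ₗ[A] P} {g : P →ₗ[A] Q}
    (hg : Function.Surjective g) (h : LinearMap.ker g ≤ LinearMap.range f) :
    Module.length A P ≤ Module.length A M + Module.length A Q := by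
  rw [Module.length_eq_add_of_exact (LinearMap.ker g).subtype g (Submodule.subtype_injective _) hg
    (LinearMap.exact_subtype_ker_map g)]
  refine add_le_add_left ((length_submodule_mono h).trans ?_) _
  exact Module.length_le_of_surjective f.rangeRestrict f.surjective_rangeRestrict

theorem length_quotient_add_length_range_le {U V : Submodule A M} (h : U ≤ V) (g : V →ₗ[A] P)
    (hg : ∀ v : V, (v : M) ∈ U → g v = 0) :
    Module.length A (M ⧸ V) + Module.length A (LinearMap.range g) ≤ Module.length A (M ⧸ U) := by
  have h1 : Module.length A (LinearMap.range g) ≤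
      Module.length A (LinearMap.range (U.mkQ ∘ₗ V.subtype)) := by
    refine length_range_le_of_ker_le fun v hv => hg v ?_
    rwa [LinearMap.mem_ker, LinearMap.comp_apply, Submodule.mkQ_apply,
      Submodule.Quotient.mk_eq_zero] at hv
  rw [LinearMap.range_comp, Submodule.range_subtype] at h1
  have h2 := length_add_length_map_le (U := V.map U.mkQ) (V := ⊤) le_top (Submodule.factor h) (by
    rw [Submodule.map_le_iff_le_comap]
    intro v hv
    rw [Submodule.mem_comap, LinearMap.mem_ker, Submodule.factor_mk]
    exact (Submodule.Quotient.mk_eq_zero _).mpr hv)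
  rw [Submodule.map_top, LinearMap.range_eq_top.mpr (Submodule.factor_surjective h),
    Module.length_top, Module.length_top] at h2
  rw [add_comm]
  exact (add_le_add_left h1 _).trans h2

/-- Right exactness of `A/(J, y) → A/(J, xy) → A/(J, x) → 0`, the first map being multiplication by
`x`. -/
theorem length_quotient_sup_span_mul_le (J : Ideal A) (x y : A) :
    Module.length A (A ⧸ J ⊔ Ideal.span {x * y}) ≤
      Module.length A (A ⧸ J ⊔ Ideal.span {y}) + Module.length A (A ⧸ J ⊔ Ideal.span {x}) := by
  have h1 : J ⊔ Ideal.span {y} ≤ 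
      Submodule.comap (LinearMap.mulLeft A x) (J ⊔ Ideal.span {x * y}) := by
    refine sup_le (fun a ha => ?_) ?_
    · exact Ideal.mem_sup_left (J.mul_mem_left x ha)
    · rw [Ideal.span_le, Set.singleton_subset_iff]
      exact Ideal.mem_sup_right (Ideal.mem_span_singleton_self _)
  have h2 : J ⊔ Ideal.span {x * y} ≤ J ⊔ Ideal.span {x} := by
    refine sup_le_sup_left ?_ _
    rw [Ideal.span_singleton_le_span_singleton]
    exact dvd_mul_right x y
  refine length_le_add_of_ker_le_range (f := Submodule.mapQ _ _ _ h1) (g := Submodule.factor h2)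
    (Submodule.factor_surjective h2) ?_
  intro b hb
  obtain ⟨b, rfl⟩ := Submodule.mkQ_surjective _ b
  have hb' : b ∈ J ⊔ Ideal.span {x} := by
    rwa [LinearMap.mem_ker, Submodule.factor_mk, Submodule.mkQ_apply,
      Submodule.Quotient.mk_eq_zero] at hb
  obtain ⟨z, hz, w, hw, rfl⟩ := Submodule.mem_sup.mp hb'
  obtain ⟨c, rfl⟩ := Ideal.mem_span_singleton'.mp hw
  refine ⟨Submodule.Quotient.mk c, ?_⟩
  rw [Submodule.mapQ_apply, Submodule.mkQ_apply, Submodule.Quotient.eq]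
  refine Ideal.mem_sup_left ?_
  have : LinearMap.mulLeft A x c - (z + c * x) = -z := by
    rw [LinearMap.mulLeft_apply]; ring
  rw [this]
  exact neg_mem hz

theorem length_quotient_sup_span_pow_le (J : Ideal A) (x : A) (n : ℕ) :
    Module.length A (A ⧸ J ⊔ Ideal.span {x ^ n}) ≤
      n * Module.length A (A ⧸ J ⊔ Ideal.span {x}) := by
  induction n with
  | zero =>
    have : Subsingleton (A ⧸ J ⊔ Ideal.span {x ^ 0}) := by
      rw [Ideal.Quotient.subsingleton_iff, pow_zero, Ideal.span_singleton_one, sup_top_eq]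
    simp
  | succ n ih =>
    rw [pow_succ', Nat.cast_succ, add_mul, one_mul]
    exact (length_quotient_sup_span_mul_le J x (x ^ n)).trans (add_le_add_left ih _)

theorem length_quotient_sup_span_image_pow_le (n : ℕ) (s : Finset A) (J : Ideal A) :
    Module.length A (A ⧸ J ⊔ Ideal.span ((· ^ n) '' (s : Set A))) ≤
      (n : ℕ∞) ^ s.card * Module.length A (A ⧸ J ⊔ Ideal.span (s : Set A)) := by
  classical
  induction s using Finset.induction_on generalizing J with
  | empty => rw [Finset.card_empty, pow_zero, one_mul, Finset.coe_empty, Set.image_empty]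
  | insert x s hx ih =>
    rw [Finset.card_insert_of_notMem hx, Finset.coe_insert, Set.image_insert_eq,
      Ideal.span_insert, Ideal.span_insert, ← sup_assoc, ← sup_assoc]
    refine (ih _).trans ?_
    rw [pow_succ, mul_assoc, sup_right_comm J, sup_right_comm J (Ideal.span {x})]
    refine mul_le_mul' le_rfl ?_
    exact length_quotient_sup_span_pow_le _ x n

theorem length_quotient_le_of_le {J K : Ideal A} (h : J ≤ K) :
    Module.length A (A ⧸ K) ≤ Module.length A (A ⧸ J) :=
  Module.length_le_of_surjective (Submodule.factor h) (Submodule.factor_surjective h)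

/-- The length of `A / Iⁿ` grows at most like `n ^ dim A`. -/
theorem exists_length_quotient_pow_le [IsLocalRing A] [IsNoetherianRing A] {I : Ideal A}
    (hrad : I.radical = maximalIdeal A) {d : ℕ} (hd : ringKrullDim A = d) :
    ∃ K : ℕ, ∀ n : ℕ, Module.length A (A ⧸ I ^ n) ≤ (K * n ^ d : ℕ) := by
  -- `s` is a system of parameters.
  obtain ⟨s, hs, hcard⟩ :=
    (maximalIdeal A).exists_finset_card_eq_height_of_isNoetherianRing
  have hcard' : s.card = d := by
    rw [← IsLocalRing.maximalIdeal_height_eq_ringKrullDim, ← hcard] at hd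
    exact_mod_cast hd
  obtain ⟨c, hc⟩ := Ideal.exists_radical_pow_le_of_fg I (IsNoetherian.noetherian _)
  rw [hrad] at hc
  have hart := IsLocalRing.quotient_artinian_of_mem_minimalPrimes_of_isLocalRing _ hs
  have hfin : Module.length A (A ⧸ Ideal.span (s : Set A)) ≠ ⊤ := by
    rw [Module.length_eq_of_surjective (R := A ⧸ Ideal.span (s : Set A))
      Ideal.Quotient.mk_surjective]
    exact Module.length_ne_top
  obtain ⟨L, hL⟩ := ENat.ne_top_iff_exists.mp hfin
  refine ⟨c ^ d * L, fun n => ?_⟩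
  -- Since `𝔪ᶜ ⊆ I`, the powers `x ^ (c * n)` of the parameters lie in `Iⁿ`; they cut out length at
  -- most `(c * n) ^ d * L`.
  have h1 : (⊥ : Ideal A) ⊔ Ideal.span ((· ^ (c * n)) '' (s : Set A)) ≤ I ^ n := by
    rw [bot_sup_eq, Ideal.span_le, Set.image_subset_iff]
    intro x hx
    have h2 : x ^ c ∈ I := hc (Ideal.pow_mem_pow (hs.1.2 (Ideal.subset_span hx)) c)
    have := Ideal.pow_mem_pow h2 n
    rwa [← pow_mul] at this
  refine (length_quotient_le_of_le h1).trans
    ((length_quotient_sup_span_image_pow_le (c * n) s ⊥).trans (le_of_eq ?_))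
  rw [bot_sup_eq, hcard', ← hL]
  push_cast
  ring

end Length

/-! ### Upper bound for the dimension through Hilbert functions. -/

section HilbertFunction

variable {A : Type u} [CommRing A] [IsLocalRing A] (I : Ideal A)

/-- The length of the degree `n` part of the quotient of the fiber cone by `p`. -/
noncomputable def hilbertLength (p : Ideal (FiberCone I)) (n : ℕ) : ℕ∞ :=
  Module.length A ((fiberConePiece I n).map (Ideal.Quotient.mkₐ A p).toLinearMap)

theorem fiberConeOf_eq_zero_of_mem_pow_succ (hI : I ≤ maximalIdeal A) (n : ℕ) :
    ∀ r ∈ I ^ (n + 1), ∀ h : r ∈ I ^ n, fiberConeOf I n ⟨r, h⟩ = 0 := by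
  intro r hr
  rw [pow_succ'] at hr
  induction hr using Submodule.mul_induction_on' with
  | mem_mul_mem y hy b hb =>
    intro h
    have := fiberCone_smul_eq_zero I (hI hy) (fiberConeOf I n ⟨b, hb⟩)
    rwa [← map_smul] at this
  | add a ha b hb iha ihb =>
    intro h
    have hle : I * I ^ n ≤ I ^ n := Ideal.mul_le_right
    have e : (⟨a + b, h⟩ : ↥(I ^ n)) = ⟨a, hle ha⟩ + ⟨b, hle hb⟩ := rfl
    rw [e, map_add, iha, ihb, add_zero]

/-- As `I ⊆ 𝔪`, the module `Iⁿ / 𝔪Iⁿ` is a quotient of `Iⁿ / Iⁿ⁺¹`. -/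
theorem hilbertLength_add_length_le (hI : I ≤ maximalIdeal A) (p : Ideal (FiberCone I)) (n : ℕ) :
    Module.length A (A ⧸ I ^ n) + hilbertLength I p n ≤ Module.length A (A ⧸ I ^ (n + 1)) := by
  have h := length_quotient_add_length_range_le (Ideal.pow_le_pow_right n.le_succ : I ^ (n + 1) ≤ I ^ n)
    ((Ideal.Quotient.mkₐ A p).toLinearMap ∘ₗ fiberConeOf I n) (fun r hr => by
      rw [LinearMap.comp_apply, fiberConeOf_eq_zero_of_mem_pow_succ I hI n r hr r.2, map_zero])
  rwa [LinearMap.range_comp] at h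

theorem sum_hilbertLength_le (hI : I ≤ maximalIdeal A) (p : Ideal (FiberCone I)) (N : ℕ) :
    ∑ n ∈ Finset.range N, hilbertLength I p n ≤ Module.length A (A ⧸ I ^ N) := by
  induction N with
  | zero => simp
  | succ N ih =>
    rw [Finset.sum_range_succ]
    exact (add_le_add_left ih _).trans (hilbertLength_add_length_le I hI p N)

theorem map_factor_map_mk {p q : Ideal (FiberCone I)} (h : p ≤ q) (n : ℕ) :
    ((fiberConePiece I n).map (Ideal.Quotient.mkₐ A p).toLinearMap).map
      (Ideal.Quotient.factorₐ A h).toLinearMap =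
      (fiberConePiece I n).map (Ideal.Quotient.mkₐ A q).toLinearMap := by
  rw [← Submodule.map_comp]
  rfl

theorem hilbertLength_anti {p q : Ideal (FiberCone I)} (h : p ≤ q) (n : ℕ) :
    hilbertLength I q n ≤ hilbertLength I p n := by
  have := length_add_length_map_le (U := ⊥) bot_le (V := (fiberConePiece I n).map
    (Ideal.Quotient.mkₐ A p).toLinearMap) (Ideal.Quotient.factorₐ A h).toLinearMap bot_le
  rw [map_factor_map_mk] at this
  exact le_add_self.trans this

/-- Multiplication by `f` is injective on the domain `R / p`, and its image dies in `R / q`. -/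
theorem hilbertLength_add_le {p q : Ideal (FiberCone I)} [p.IsPrime] (h : p ≤ q) {b : ℕ}
    {f : FiberCone I} (hf : f ∈ fiberConePiece I b) (hfq : f ∈ q) (hfp : f ∉ p) (n : ℕ) :
    hilbertLength I p n + hilbertLength I q (b + n) ≤ hilbertLength I p (b + n) := by
  have hinj : Function.Injective (LinearMap.mulLeft A (Ideal.Quotient.mk p f)) := by
    have : Ideal.Quotient.mk p f ≠ 0 := by rwa [Ne, Ideal.Quotient.eq_zero_iff_mem]
    intro u v huv
    exact mul_left_cancel₀ this huv
  have h1 := length_add_length_map_le (V := (fiberConePiece I (b + n)).map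
      (Ideal.Quotient.mkₐ A p).toLinearMap)
    (U := ((fiberConePiece I n).map (Ideal.Quotient.mkₐ A p).toLinearMap).map
      (LinearMap.mulLeft A (Ideal.Quotient.mk p f))) ?_ (Ideal.Quotient.factorₐ A h).toLinearMap ?_
  · rw [map_factor_map_mk, ← (Submodule.equivMapOfInjective _ hinj _).length_eq] at h1
    exact h1
  · rintro _ ⟨_, ⟨u, hu, rfl⟩, rfl⟩
    exact ⟨f * u, SetLike.mul_mem_graded hf hu, map_mul (Ideal.Quotient.mk p) f u⟩
  · rintro _ ⟨_, ⟨u, hu, rfl⟩, rfl⟩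
    exact (Ideal.Quotient.eq_zero_iff_mem (I := q)).mpr (q.mul_mem_right u hfq)

theorem sum_hilbertLength_add_le {p q : Ideal (FiberCone I)} [p.IsPrime] (h : p ≤ q) {b : ℕ}
    {f : FiberCone I} (hf : f ∈ fiberConePiece I b) (hfq : f ∈ q) (hfp : f ∉ p) (N : ℕ) :
    ∑ n ∈ Finset.range N, hilbertLength I p n + ∑ n ∈ Finset.range (b + N), hilbertLength I q n ≤
      ∑ n ∈ Finset.range (b + N), hilbertLength I p n := by
  rw [Finset.sum_range_add, Finset.sum_range_add _ b N, add_left_comm, ← Finset.sum_add_distrib]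
  exact add_le_add (Finset.sum_le_sum fun n _ => hilbertLength_anti I h n)
    (Finset.sum_le_sum fun n _ => hilbertLength_add_le I h hf hfq hfp n)

theorem one_le_hilbertLength (p : ProjectiveSpectrum (fiberConePiece I)) (n : ℕ) :
    1 ≤ hilbertLength I p.asHomogeneousIdeal.toIdeal n := by
  obtain ⟨x, hx⟩ := exists_fiberConeOne_notMem I p
  rw [Order.one_le_iff_ne_zero, hilbertLength, Ne, Module.length_eq_zero_iff]
  intro h
  have h1 : (⟨_, Submodule.mem_map_of_mem (fiberConeOne_pow_mem I n x)⟩ :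
    (fiberConePiece I n).map (Ideal.Quotient.mkₐ A p.asHomogeneousIdeal.toIdeal).toLinearMap) = 0 :=
    Subsingleton.elim _ _
  exact hx (p.isPrime.mem_of_pow_mem n
    (Ideal.Quotient.eq_zero_iff_mem.mp (congrArg Subtype.val h1)))

theorem exists_homogeneous_of_lt {p q : ProjectiveSpectrum (fiberConePiece I)} (h : p < q) :
    ∃ n, ∃ f ∈ fiberConePiece I n, f ∈ q.asHomogeneousIdeal.toIdeal ∧
      f ∉ p.asHomogeneousIdeal.toIdeal := by
  by_contra! hc
  refine h.not_ge ((ProjectiveSpectrum.as_ideal_le_as_ideal _ _ _).mp fun u hu => ?_)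
  refine (Ideal.IsHomogeneous.mem_iff _ p.asHomogeneousIdeal.isHomogeneous).mpr fun i => ?_
  exact hc i _ (SetLike.coe_mem _)
    ((Ideal.IsHomogeneous.mem_iff _ q.asHomogeneousIdeal.isHomogeneous).mp hu i)

/-- A chain of `e + 1` points of `Proj` forces growth of order at least `e + 1`. -/
theorem exists_pow_le_sum_hilbertLength (e : ℕ) :
    ∀ p : Fin (e + 1) → ProjectiveSpectrum (fiberConePiece I), StrictMono p →
      ∃ a : ℕ, ∀ j : ℕ, ((j ^ (e + 1) : ℕ) : ℕ∞) ≤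
        ∑ n ∈ Finset.range (a * j), hilbertLength I (p 0).asHomogeneousIdeal.toIdeal n := by
  induction e with
  | zero =>
    intro p _
    refine ⟨1, fun j => ?_⟩
    have := Finset.sum_le_sum (s := Finset.range (1 * j)) fun n _ => one_le_hilbertLength I (p 0) n
    simpa using this
  | succ e ih =>
    intro p hp
    obtain ⟨a, ha⟩ := ih (fun i => p i.succ) (hp.comp (Fin.strictMono_succ))
    obtain ⟨b, f, hf, hfq, hfp⟩ := exists_homogeneous_of_lt I (hp (Fin.succ_pos 0))
    have hle : (p 0).asHomogeneousIdeal.toIdeal ≤ (p (Fin.succ 0)).asHomogeneousIdeal.toIdeal :=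
      (ProjectiveSpectrum.as_ideal_le_as_ideal _ _ _).mpr (hp (Fin.succ_pos 0)).le
    -- Each enlargement of the range by `a + b ≥ b` adds the sum for `p 1` over at least `a * j`
    -- degrees, hence at least `j ^ (e + 1)`. Taking `i = j` then raises the exponent by one.
    have key : ∀ j i : ℕ, ((i * j ^ (e + 1) : ℕ) : ℕ∞) ≤
        ∑ n ∈ Finset.range ((a + b) * (j + i)),
          hilbertLength I (p 0).asHomogeneousIdeal.toIdeal n := by
      intro j i
      induction i with
      | zero => simp
      | succ i ihi =>
        have h1 : b + (a + b) * (j + i) ≤ (a + b) * (j + (i + 1)) := by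
          have : (a + b) * (j + (i + 1)) = a + (b + (a + b) * (j + i)) := by ring
          omega
        have h2 : a * j ≤ b + (a + b) * (j + i) :=
          (Nat.mul_le_mul (Nat.le_add_right a b) (Nat.le_add_right j i)).trans (Nat.le_add_left _ _)
        refine le_trans ?_ (Finset.sum_le_sum_of_subset (Finset.range_mono h1))
        refine le_trans ?_ (sum_hilbertLength_add_le I hle hf hfq hfp _)
        rw [add_mul, one_mul, Nat.cast_add]
        exact add_le_add ihi ((ha j).trans (Finset.sum_le_sum_of_subset (Finset.range_mono h2)))
    refine ⟨(a + b) * 2, fun j => ?_⟩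
    have := key j j
    rwa [← two_mul, ← mul_assoc, ← pow_succ'] at this

theorem lt_of_strictMono [IsNoetherianRing A] (hrad : I.radical = maximalIdeal A) {d : ℕ}
    (hd : ringKrullDim A = d) {e : ℕ} {p : Fin (e + 1) → ProjectiveSpectrum (fiberConePiece I)}
    (hp : StrictMono p) : e < d := by
  by_contra! hde
  obtain ⟨K, hK⟩ := exists_length_quotient_pow_le hrad hd
  obtain ⟨a, ha⟩ := exists_pow_le_sum_hilbertLength I e p hp
  have h1 : ∀ j : ℕ, j ^ (e + 1) ≤ K * (a * j) ^ d := fun j => by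
    exact_mod_cast (ha j).trans ((sum_hilbertLength_le I (hrad ▸ Ideal.le_radical) _ _).trans (hK _))
  -- This `j` exceeds the constant `K * a ^ d`, so `j ^ (d + 1)` beats the bound.
  have h2 := h1 (K * a ^ d + 1)
  set j := K * a ^ d + 1 with hj
  have h3 : j ^ (d + 1) ≤ j ^ (e + 1) := Nat.pow_le_pow_right (by omega) (by omega)
  have h4 : 0 < j ^ d := Nat.pow_pos (by omega)
  have h5 : K * (a * j) ^ d < j ^ (d + 1) := by
    rw [mul_pow, ← mul_assoc, pow_succ']
    exact Nat.mul_lt_mul_of_pos_right (by omega) h4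
  omega

end HilbertFunction

/-! ### Lower bound for the dimension through hyperplane sections. -/

section LowerBound

variable {A : Type u} [CommRing A] [IsLocalRing A] (I : Ideal A)

/-- The degree one part of the fiber cone as a vector space over the residue field. -/
noncomputable def fiberConeLinearForms : Subspace (ResidueField A) (FiberCone I) where
  carrier := fiberConePiece I 1
  add_mem' := add_mem
  zero_mem' := zero_mem _
  smul_mem' c u hu := by
    obtain ⟨a, rfl⟩ := residue_surjective c
    have h := (fiberConePiece I 1).smul_mem a hu
    rwa [← algebraMap_smul (ResidueField A) a u] at h

theorem exists_fiberConeOne_eq {u : FiberCone I} (hu : u ∈ fiberConePiece I 1) :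
    ∃ y : I, fiberConeOne I y = u := by
  obtain ⟨⟨r, hr⟩, rfl⟩ := hu
  exact ⟨⟨r, by rwa [pow_one] at hr⟩, rfl⟩

/-- A vector space over an infinite field is not a finite union of proper subspaces. -/
theorem exists_forall_fiberConeOne_notMem [Infinite (ResidueField A)] {F : Set (Ideal (FiberCone I))}
    (hF : F.Finite) (h : ∀ q ∈ F, ∃ x : I, fiberConeOne I x ∉ q) :
    ∃ y : I, ∀ q ∈ F, fiberConeOne I y ∉ q := by
  by_contra! hc
  have := hF.to_subtype
  obtain ⟨⟨q, hq⟩, htop⟩ := Subspace.exists_eq_top_of_iUnion_eq_univ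
    (p := fun q : F => ((q : Ideal (FiberCone I)).restrictScalars (ResidueField A)).comap
      (fiberConeLinearForms I).subtype) (by
    rw [Set.eq_univ_iff_forall]
    rintro ⟨u, hu⟩
    obtain ⟨y, rfl⟩ := exists_fiberConeOne_eq I hu
    obtain ⟨q, hq, hy⟩ := hc y
    exact Set.mem_iUnion.mpr ⟨⟨q, hq⟩, hy⟩)
  obtain ⟨x, hx⟩ := h q hq
  have : (⟨fiberConeOne I x, fiberConeOne_mem I x⟩ : fiberConeLinearForms I) ∈
      (q.restrictScalars (ResidueField A)).comap (fiberConeLinearForms I).subtype :=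
    htop ▸ Submodule.mem_top
  exact hx this

/-- The homogeneous core of `q` is a prime still containing `J`, so minimality makes it equal to
`q`. -/
theorem isHomogeneous_of_mem_minimalPrimes {J q : Ideal (FiberCone I)}
    (hJ : J.IsHomogeneous (fiberConePiece I)) (hq : q ∈ J.minimalPrimes) :
    q.IsHomogeneous (fiberConePiece I) := by
  rw [Ideal.IsHomogeneous.iff_eq]
  refine le_antisymm (Ideal.toIdeal_homogeneousCore_le _ _)
    (hq.2 ⟨Ideal.IsPrime.homogeneousCore hq.1.1, ?_⟩ (Ideal.toIdeal_homogeneousCore_le _ _))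
  rw [← hJ.toIdeal_homogeneousCore_eq_self]
  exact Ideal.homogeneousCore_mono (fiberConePiece I) hq.1.2

/-- If the closed subset of `Proj` defined by `J` has dimension `< e`, then it misses an
intersection of `e` hyperplanes. -/
theorem exists_finset_forall_not_le [IsNoetherianRing A] [Infinite (ResidueField A)] (e : ℕ) :
    ∀ J : Ideal (FiberCone I), J.IsHomogeneous (fiberConePiece I) →
      (∀ p : Fin (e + 1) → ProjectiveSpectrum (fiberConePiece I), StrictMono p →
        ¬ J ≤ (p 0).asHomogeneousIdeal.toIdeal) →
      ∃ s : Finset I, s.card ≤ e ∧ ∀ q : ProjectiveSpectrum (fiberConePiece I),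
        ¬ J ⊔ Ideal.span (fiberConeOne I '' s) ≤ q.asHomogeneousIdeal.toIdeal := by
  classical
  induction e with
  | zero =>
    intro J _ h
    exact ⟨∅, le_rfl, fun q hq => h (fun _ => q) (Subsingleton.strictMono (α := Fin 1) _) (le_sup_left.trans hq)⟩
  | succ e ih =>
    intro J hJ h
    -- The hyperplane `y = 0` contains no component of the locus of `J`, so any chain inside the
    -- section extends downwards by a minimal prime of `J`.
    obtain ⟨y, hy⟩ := exists_forall_fiberConeOne_notMem I
      (F := {q ∈ J.minimalPrimes | ∃ x : I, fiberConeOne I x ∉ q})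
      ((Ideal.finite_minimalPrimes_of_isNoetherianRing _ J).subset fun q hq => hq.1)
      (fun q hq => hq.2)
    have hJ' : (J ⊔ Ideal.span {fiberConeOne I y}).IsHomogeneous (fiberConePiece I) := by
      refine hJ.sup (Ideal.homogeneous_span _ _ ?_)
      rintro _ rfl
      exact ⟨1, fiberConeOne_mem I y⟩
    have hlt : ∀ p : Fin (e + 1) → ProjectiveSpectrum (fiberConePiece I), StrictMono p →
        ¬ J ⊔ Ideal.span {fiberConeOne I y} ≤ (p 0).asHomogeneousIdeal.toIdeal := by
      intro p hp hJp
      obtain ⟨q, hq, hqp⟩ := Ideal.exists_minimalPrimes_le (le_sup_left.trans hJp)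
      obtain ⟨x, hx⟩ := exists_fiberConeOne_notMem I (p 0)
      have hyq := hy q ⟨hq, x, fun hxq => hx (hqp hxq)⟩
      let Q : ProjectiveSpectrum (fiberConePiece I) :=
        ⟨⟨q, isHomogeneous_of_mem_minimalPrimes I hJ hq⟩, hq.1.1,
          fun hirr => (p 0).not_irrelevant_le (hirr.trans hqp)⟩
      have hQ : Q < p 0 := by
        rw [← ProjectiveSpectrum.as_ideal_lt_as_ideal]
        refine lt_of_le_not_ge hqp fun hpq => hyq (hpq (hJp ?_))
        exact Ideal.mem_sup_right (Ideal.mem_span_singleton_self _)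
      refine h (Fin.cons Q p) ?_ hq.1.2
      rw [Fin.strictMono_iff_lt_succ]
      intro i
      refine Fin.cases ?_ (fun i => ?_) i
      · simpa using hQ
      · rw [← Fin.succ_castSucc, Fin.cons_succ, Fin.cons_succ]
        exact hp i.castSucc_lt_succ
    obtain ⟨s, hs, hsq⟩ := ih _ hJ' hlt
    refine ⟨insert y s, (Finset.card_insert_le _ _).trans (Nat.succ_le_succ hs), fun q hq => ?_⟩
    refine hsq q (le_trans (le_of_eq ?_) hq)
    rw [Finset.coe_insert, Set.image_insert_eq, Ideal.span_insert, sup_assoc]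

theorem fiberConePiece_le_irrelevant_pow (n : ℕ) : ∀ u ∈ fiberConePiece I n,
    u ∈ (HomogeneousIdeal.irrelevant (fiberConePiece I)).toIdeal ^ n := by
  induction n with
  | zero => intro u _; simp
  | succ n ih =>
    refine fiberConePiece_succ_induction I (fun y v hv => ?_) fun _ _ => Ideal.add_mem _
    rw [pow_succ']
    exact Ideal.mul_mem_mul
      (HomogeneousIdeal.mem_irrelevant_of_mem _ one_pos (fiberConeOne_mem I y)) (ih v hv)

/-- The radical is the intersection of the homogeneous primes above `J`, none of which is relevant.
-/
theorem irrelevant_le_radical {J : Ideal (FiberCone I)} (hJ : J.IsHomogeneous (fiberConePiece I))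
    (h : ∀ q : ProjectiveSpectrum (fiberConePiece I), ¬ J ≤ q.asHomogeneousIdeal.toIdeal) :
    (HomogeneousIdeal.irrelevant (fiberConePiece I)).toIdeal ≤ J.radical := by
  rw [hJ.radical_eq]
  refine le_sInf ?_
  rintro K ⟨hK, hJK, hprime⟩
  by_contra hirr
  exact h ⟨⟨K, hK⟩, hprime, hirr⟩ hJK

/-- If the hyperplanes defined by `s` have no common point on `Proj`, then `s` generates an ideal
containing a power of `I`. -/
theorem exists_pow_le_span [IsNoetherianRing A] {s : Finset I}
    (h : ∀ q : ProjectiveSpectrum (fiberConePiece I),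
      ¬ Ideal.span (fiberConeOne I '' s) ≤ q.asHomogeneousIdeal.toIdeal) :
    ∃ n, I ^ n ≤ Ideal.span (Subtype.val '' (s : Set I)) := by
  have hhom : (Ideal.span (fiberConeOne I '' s)).IsHomogeneous (fiberConePiece I) := by
    refine Ideal.homogeneous_span _ _ ?_
    rintro _ ⟨y, -, rfl⟩
    exact ⟨1, fiberConeOne_mem I y⟩
  obtain ⟨N, hN⟩ := Ideal.exists_pow_le_of_le_radical_of_fg (irrelevant_le_radical I hhom h)
    (IsNoetherian.noetherian _)
  set J : Ideal A := Ideal.span (Subtype.val '' (s : Set I)) with hJ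
  -- `J` is enlarged by `𝔪I` because `reesIdeal` requires it; Nakayama removes the excess.
  have hspan : Ideal.span (fiberConeOne I '' s) ≤ fiberConeSpan I (J ⊔ maximalIdeal A * I) := by
    refine Ideal.span_mono (Set.image_mono fun y hy => ?_)
    exact Ideal.mem_sup_left (Ideal.subset_span ⟨y, hy, rfl⟩)
  have key : I ^ (N + 1) ≤ J ⊔ maximalIdeal A • I ^ (N + 1) := by
    intro r hr
    have h1 := hspan (hN (Ideal.pow_le_pow_right N.le_succ
      (fiberConePiece_le_irrelevant_pow I (N + 1) _ ⟨⟨r, hr⟩, rfl⟩)))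
    have h2 := (mem_reesIdeal_of_mem_fiberConeSpan I le_sup_right
      (f := reesOf I (N + 1) ⟨r, hr⟩) h1).2 N
    have h3 : r ∈ (J ⊔ maximalIdeal A * I) * I ^ N := by simpa [reesOf] using h2
    rw [Ideal.sup_mul, mul_assoc, ← pow_succ'] at h3
    have h4 : J * I ^ N ≤ J := Ideal.mul_le_left
    exact (sup_le_sup_right h4 (maximalIdeal A * I ^ (N + 1)) :) h3
  refine ⟨N + 1, Submodule.le_of_le_smul_of_le_jacobson_bot (IsNoetherian.noetherian _) ?_ key⟩
  rw [IsLocalRing.jacobson_eq_maximalIdeal ⊥ bot_ne_top]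

theorem exists_strictMono_of_ringKrullDim [IsNoetherianRing A] [Infinite (ResidueField A)]
    (hrad : I.radical = maximalIdeal A) {e : ℕ} (hd : ringKrullDim A = (e + 1 : ℕ)) :
    ∃ p : Fin (e + 1) → ProjectiveSpectrum (fiberConePiece I), StrictMono p := by
  classical
  by_contra! hc
  obtain ⟨s, hs, h⟩ := exists_finset_forall_not_le I e ⊥ (Ideal.IsHomogeneous.bot _)
    fun p hp => absurd hp (hc p)
  simp only [bot_sup_eq] at h
  obtain ⟨n, hn⟩ := exists_pow_le_span I h
  rw [← Finset.coe_image] at hn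
  have hmin : maximalIdeal A ∈ (Ideal.span ((s.image Subtype.val : Finset A) : Set A)).minimalPrimes := by
    refine ⟨⟨inferInstance, ?_⟩, fun Q ⟨hQ, hle⟩ _ => ?_⟩
    · rw [← hrad, Ideal.span_le, Finset.coe_image]
      rintro _ ⟨y, -, rfl⟩
      exact Ideal.le_radical y.2
    · rw [← hrad, hQ.radical_le_iff]
      exact hQ.le_of_pow_le (hn.trans hle)
  have h1 := Ideal.height_le_card_of_mem_minimalPrimes_span_finset hmin
  rw [← IsLocalRing.maximalIdeal_height_eq_ringKrullDim] at hd
  have h2 : (maximalIdeal A).height = (e + 1 : ℕ) := by exact_mod_cast hd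
  rw [h2, Nat.cast_le] at h1
  have := Finset.card_image_le (s := s) (f := Subtype.val)
  omega

end LowerBound

/-! ### Dimension of `Proj`, and the theorem. -/

section Dimension

variable {A : Type u} [CommRing A] [IsLocalRing A] (I : Ideal A)

/-- Irreducible closed sets correspond to their generic points; specialization reverses inclusion of
primes, which leaves the Krull dimension unchanged. -/
theorem topologicalKrullDim_fiberConeProj : topologicalKrullDim (fiberConeProj I) =
    Order.krullDim (ProjectiveSpectrum (fiberConePiece I)) := by
  let := specializationOrder (fiberConeProj I)
  rw [topologicalKrullDim, Order.krullDim_eq_of_orderIso irreducibleSetEquivPoints,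
    ← Order.krullDim_orderDual (α := ProjectiveSpectrum (fiberConePiece I))]
  refine Order.krullDim_eq_of_orderIso
    { toEquiv := (OrderDual.toDual : ProjectiveSpectrum (fiberConePiece I) ≃ _)
      map_rel_iff' := fun {x y} => ?_ }
  refine Iff.trans ?_ (specializes_iff_mem_closure (x := y) (y := x)).symm
  exact ProjectiveSpectrum.le_iff_mem_closure _ _ _

theorem topologicalKrullDim_fiberConeProj_eq [IsNoetherianRing A] [Infinite (ResidueField A)]
    (hrad : I.radical = maximalIdeal A) {d : ℕ} (hd : ringKrullDim A = d) (hpos : 0 < d) :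
    topologicalKrullDim (fiberConeProj I) = ((d - 1 : ℕ) : WithBot ℕ∞) := by
  obtain ⟨e, rfl⟩ := Nat.exists_eq_add_of_le' hpos
  rw [topologicalKrullDim_fiberConeProj, Nat.add_sub_cancel]
  refine le_antisymm (iSup_le fun s => ?_) ?_
  · have := lt_of_strictMono I hrad hd s.strictMono
    exact_mod_cast Nat.lt_succ_iff.mp this
  · obtain ⟨p, hp⟩ := exists_strictMono_of_ringKrullDim I hrad hd
    exact Order.LTSeries.length_le_krullDim (LTSeries.mk e p hp)

theorem isEmpty_fiberConeProj [IsNoetherianRing A] (hrad : I.radical = maximalIdeal A)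
    (hd : ringKrullDim A = 0) : IsEmpty (fiberConeProj I) :=
  ⟨fun p => (lt_of_strictMono I hrad (d := 0) (e := 0) (p := fun _ => p) (by exact_mod_cast hd)
    (Subsingleton.strictMono (α := Fin 1) _)).false⟩

end Dimension

theorem proposition3p1 {A : Type u} [CommRing A] [IsLocalRing A] [IsNoetherianRing A]
    [IsAlgClosed (IsLocalRing.ResidueField A)]
    (I : Ideal A) (hprim : I.IsPrimary) (hrad : I.radical = IsLocalRing.maximalIdeal A)
    (hI : IsIntegrallyClosedIdeal I) (d : ℕ) (hd : ringKrullDim A = d) :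
    Set.BijOn (idealOfPoint I) {p : fiberConeProj I | IsClosed ({p} : Set (fiberConeProj I))}
      (adjacentIntegrallyClosedIdeals I) ∧
    IsProper (fiberConeProjToSpec I) ∧
    (0 < d → topologicalKrullDim (fiberConeProj I) = ((d - 1 : ℕ) : WithBot ℕ∞)) ∧
    (d = 0 → IsEmpty (fiberConeProj I)) := by
  have : Infinite (ResidueField A) := IsAlgClosed.instInfinite
  refine ⟨idealOfPoint_bijOn I hI, isProper_fiberConeProjToSpec I,
    topologicalKrullDim_fiberConeProj_eq I hrad hd, ?_⟩
  rintro rfl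
  exact isEmpty_fiberConeProj I hrad hd
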